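/- There is an absolute constant $c>0$ such that the following holds. Let $m,n,r\ge 0$ be integers and let $M\in\{0,1\}^{m\times n}$ be a binary matrix whose rank over $\mathbb{R}$ satisfies $\operatorname{rank}(M)\le r$. Then there exist a set of rows $X\subseteq\{1,\dots,m\}$ and a set of columns $Y\subseteq\{1,\dots,n\}$ such that $$|X|\ge \frac{m}{2^{c\sqrt r}}\quad\text{and}\quad |Y|\ge \frac{n}{2^{c\sqrt r}},$$ and the submatrix $M[X\times Y]$ contains only $0$ entries or only $1$ entries. -/

import Mathlib

/-! After complementing, let the density be `p ≤ 1/2`, and write `M i j = ⟨x i, y j⟩` in an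
orthonormal basis of the column space: the squared row norms sum to the rank, and each squared
column norm is the number of ones in that column. Away from a few long rows and dense columns, the
norms multiply to `O(√(r p))`. Pairing `M - p` with this same Gram matrix gives about `p m n`,
because `M` is binary. By Grothendieck's inequality (`CutBound.hilbertBound`) some rectangle sum of
`M - p` has size of order `m n √(p / r)`. It may be taken negative since the total is zero
(`exists_sparse_rectangle`).

Passing to that rectangle lowers the square root of the density from `s` to `s'` and costs each side
at most a factor `exp (O(√r (s - s')))`. These costs telescope to `exp (O(√r))`. Once `p ≤ 1 / (4
r)`, a sparse column basis yields a zero rectangle. -/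

/-- All rectangle sums of `A` are at most `D` in absolute value. -/
def CutBound {ι κ : Type} [Fintype ι] [Fintype κ] (A : ι → κ → ℝ) (D : ℝ) : Prop :=
  ∀ (X : Finset ι) (Y : Finset κ), |∑ i ∈ X, ∑ j ∈ Y, A i j| ≤ D

/-- `K` bounds the bilinear form of `A` on families of vectors of Euclidean norm at most one. -/
def HilbertBound {ι κ : Type} [Fintype ι] [Fintype κ] (A : ι → κ → ℝ) (K : ℝ) : Prop :=
  ∀ (Ω : Type) [Fintype Ω] (x : ι → Ω → ℝ) (y : κ → Ω → ℝ),
    (∀ i, ∑ k, x i k ^ 2 ≤ 1) → (∀ j, ∑ k, y j k ^ 2 ≤ 1) →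
    ∑ i, ∑ j, A i j * ∑ k, x i k * y j k ≤ K

/-! ### Rectangle sums against bounded weights -/

theorem exists_finset_sum_mul_le {ι : Type} [Fintype ι] (f u : ι → ℝ)
    (h0 : ∀ i, 0 ≤ u i) (h1 : ∀ i, u i ≤ 1) :
    ∃ X : Finset ι, ∑ i, u i * f i ≤ ∑ i ∈ X, f i := by
  classical
  refine ⟨Finset.univ.filter (fun i => 0 < f i), ?_⟩
  rw [Finset.sum_filter]
  refine Finset.sum_le_sum fun i _ => ?_
  split_ifs with h
  · nlinarith [h1 i]
  · nlinarith [h0 i]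

section
variable {ι κ : Type} [Fintype ι] [Fintype κ] {A : ι → κ → ℝ} {D : ℝ}

/-- The form is linear in each of `u` and `v` separately, so its maximum over the cube is reached at
indicators. -/
theorem sum_mul_le_of_forall_cut_le (h : ∀ (X : Finset ι) (Y : Finset κ), ∑ i ∈ X, ∑ j ∈ Y, A i j ≤ D)
    (u : ι → ℝ) (v : κ → ℝ)
    (hu0 : ∀ i, 0 ≤ u i) (hu1 : ∀ i, u i ≤ 1) (hv0 : ∀ i, 0 ≤ v i) (hv1 : ∀ i, v i ≤ 1) :
    ∑ i, ∑ j, A i j * (u i * v j) ≤ D := by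
  obtain ⟨X, hX⟩ := exists_finset_sum_mul_le (fun i => ∑ j, A i j * v j) u hu0 hu1
  obtain ⟨Y, hY⟩ := exists_finset_sum_mul_le (fun j => ∑ i ∈ X, A i j) v hv0 hv1
  calc ∑ i, ∑ j, A i j * (u i * v j) = ∑ i, u i * ∑ j, A i j * v j := by
        refine Finset.sum_congr rfl fun i _ => ?_
        rw [Finset.mul_sum]
        exact Finset.sum_congr rfl fun j _ => by ring
    _ ≤ ∑ i ∈ X, ∑ j, A i j * v j := hX
    _ = ∑ j, v j * ∑ i ∈ X, A i j := by
        rw [Finset.sum_comm]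
        refine Finset.sum_congr rfl fun i _ => ?_
        rw [Finset.mul_sum]
        exact Finset.sum_congr rfl fun j _ => by ring
    _ ≤ ∑ j ∈ Y, ∑ i ∈ X, A i j := hY
    _ = ∑ i ∈ X, ∑ j ∈ Y, A i j := Finset.sum_comm
    _ ≤ D := h X Y

theorem CutBound.abs_sum_mul_le (h : CutBound A D) (u : ι → ℝ) (v : κ → ℝ)
    (hu0 : ∀ i, 0 ≤ u i) (hu1 : ∀ i, u i ≤ 1) (hv0 : ∀ i, 0 ≤ v i) (hv1 : ∀ i, v i ≤ 1) :
    |∑ i, ∑ j, A i j * (u i * v j)| ≤ D := by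
  rw [abs_le']
  constructor
  · exact sum_mul_le_of_forall_cut_le (fun X Y => (abs_le.1 (h X Y)).2) u v hu0 hu1 hv0 hv1
  · have := sum_mul_le_of_forall_cut_le (A := fun i j => - A i j) (D := D)
      (fun X Y => by
        simp only [Finset.sum_neg_distrib]
        linarith [(abs_le.1 (h X Y)).1]) u v hu0 hu1 hv0 hv1
    simpa [Finset.sum_neg_distrib] using this

/-- Splitting `u / c` and `v / c` into positive and negative parts leaves four forms with weights in
`[0, 1]`. -/
theorem CutBound.sum_mul_le_of_abs_le (h : CutBound A D) (u : ι → ℝ) (v : κ → ℝ)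
    {c : ℝ} (hc : 0 < c) (hu : ∀ i, |u i| ≤ c) (hv : ∀ j, |v j| ≤ c) :
    ∑ i, ∑ j, A i j * (u i * v j) ≤ c ^ 2 * (4 * D) := by
  have key : ∀ t : ℝ, |t| ≤ c → (0 ≤ max (t / c) 0 ∧ max (t / c) 0 ≤ 1) ∧
      (0 ≤ max (-t / c) 0 ∧ max (-t / c) 0 ≤ 1) ∧ t = c * (max (t / c) 0 - max (-t / c) 0) := by
    intro t ht
    obtain ⟨h1, h2⟩ := abs_le.1 ht
    refine ⟨⟨le_max_right _ _, max_le ((div_le_one hc).2 h2) zero_le_one⟩,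
      ⟨le_max_right _ _, max_le ((div_le_one hc).2 (by linarith)) zero_le_one⟩, ?_⟩
    rcases le_total 0 t with h | h
    · rw [max_eq_left (div_nonneg h hc.le),
        max_eq_right (div_nonpos_of_nonpos_of_nonneg (by linarith) hc.le)]
      field_simp; ring
    · rw [max_eq_right (div_nonpos_of_nonpos_of_nonneg h hc.le),
        max_eq_left (div_nonneg (by linarith) hc.le)]
      field_simp; ring
  set up : ι → ℝ := fun i => max (u i / c) 0
  set um : ι → ℝ := fun i => max (-u i / c) 0
  set vp : κ → ℝ := fun i => max (v i / c) 0
  set vm : κ → ℝ := fun i => max (-v i / c) 0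
  have e : ∑ i, ∑ j, A i j * (u i * v j) = c ^ 2 * (
      ((∑ i, ∑ j, A i j * (up i * vp j)) - ∑ i, ∑ j, A i j * (up i * vm j)) -
      ((∑ i, ∑ j, A i j * (um i * vp j)) - ∑ i, ∑ j, A i j * (um i * vm j))) := by
    simp only [← Finset.sum_sub_distrib, Finset.mul_sum]
    refine Finset.sum_congr rfl fun i _ => Finset.sum_congr rfl fun j _ => ?_
    rw [(key _ (hu i)).2.2, (key _ (hv j)).2.2]
    simp only [up, um, vp, vm]
    ring
  rw [e]
  refine mul_le_mul_of_nonneg_left ?_ (sq_nonneg c)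
  have a1 := abs_le.1 (h.abs_sum_mul_le up vp (fun i => (key _ (hu i)).1.1)
    (fun i => (key _ (hu i)).1.2) (fun i => (key _ (hv i)).1.1) (fun i => (key _ (hv i)).1.2))
  have a2 := abs_le.1 (h.abs_sum_mul_le up vm (fun i => (key _ (hu i)).1.1)
    (fun i => (key _ (hu i)).1.2) (fun i => (key _ (hv i)).2.1.1) (fun i => (key _ (hv i)).2.1.2))
  have a3 := abs_le.1 (h.abs_sum_mul_le um vp (fun i => (key _ (hu i)).2.1.1)
    (fun i => (key _ (hu i)).2.1.2) (fun i => (key _ (hv i)).1.1) (fun i => (key _ (hv i)).1.2))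
  have a4 := abs_le.1 (h.abs_sum_mul_le um vm (fun i => (key _ (hu i)).2.1.1)
    (fun i => (key _ (hu i)).2.1.2) (fun i => (key _ (hv i)).2.1.1) (fun i => (key _ (hv i)).2.1.2))
  linarith

/-! ### Random signs and Grothendieck's inequality -/

/-- A finite sample space carrying `d` independent signs: covariance and fourth moment. -/
theorem exists_rademacher (d : ℕ) : ∃ (Ω : Type) (_ : Fintype Ω) (φ : Ω → Fin d → ℝ),
    0 < Fintype.card Ω ∧
    (∀ x y : Fin d → ℝ, ∑ ω, (∑ k, φ ω k * x k) * (∑ k, φ ω k * y k) =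
      Fintype.card Ω * ∑ k, x k * y k) ∧
    (∀ x : Fin d → ℝ, ∑ ω, (∑ k, φ ω k * x k) ^ 4 ≤
      3 * Fintype.card Ω * (∑ k, x k ^ 2) ^ 2) := by
  induction d with
  | zero => exact ⟨Unit, inferInstance, fun _ _ => 0, by simp, by simp, by simp⟩
  | succ d ih =>
    obtain ⟨Ω, _, φ, h0, h2, h4⟩ := ih
    refine ⟨Ω × Bool, inferInstance,
      fun ω => Fin.cons (if ω.2 then 1 else -1) (φ ω.1), by simpa using h0, ?_, ?_⟩
    · intro x y
      have := h2 (fun k => x k.succ) (fun k => y k.succ)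
      simp only [Fintype.sum_prod_type, Fintype.sum_bool, Fin.sum_univ_succ, Fin.cons_zero,
        Fin.cons_succ, Fintype.card_prod, Fintype.card_bool]
      push_cast
      rw [mul_add, mul_assoc, mul_assoc, mul_left_comm _ (2 : ℝ) (∑ k : Fin d, _), ← this]
      have hc : (Fintype.card Ω : ℝ) * (2 * (x 0 * y 0)) = ∑ _ω : Ω, 2 * (x 0 * y 0) := by simp
      rw [hc, Finset.mul_sum, ← Finset.sum_add_distrib]
      refine Finset.sum_congr rfl fun ω _ => ?_
      simp
      ring
    · intro x
      have h2' := h2 (fun k => x k.succ) (fun k => x k.succ)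
      have h4' := h4 (fun k => x k.succ)
      simp only [Fintype.sum_prod_type, Fintype.sum_bool, Fin.sum_univ_succ, Fin.cons_zero,
        Fin.cons_succ, Fintype.card_prod, Fintype.card_bool]
      push_cast
      set S : Ω → ℝ := fun ω => ∑ k, φ ω k * x k.succ with hS
      set s := ∑ k : Fin d, x k.succ ^ 2 with hs
      set N : ℝ := (Fintype.card Ω : ℝ) with hN
      have e : ∑ ω, ((1 * x 0 + S ω) ^ 4 + (-1 * x 0 + S ω) ^ 4) =
          2 * ∑ ω, S ω ^ 4 + 12 * x 0 ^ 2 * ∑ ω, S ω * S ω + N * (2 * x 0 ^ 4) := by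
        have hc : N * (2 * x 0 ^ 4) = ∑ _ω : Ω, 2 * x 0 ^ 4 := by simp [hN]
        rw [hc, Finset.mul_sum, Finset.mul_sum, ← Finset.sum_add_distrib, ← Finset.sum_add_distrib]
        exact Finset.sum_congr rfl fun ω _ => by ring
      have e2 : ∑ ω, S ω * S ω = N * s := by
        rw [h2', hs]; congr 1
        exact Finset.sum_congr rfl fun k _ => by ring
      rw [e, e2]
      have hN0 : 0 ≤ N := Nat.cast_nonneg _
      -- After the induction hypothesis the two sides differ by exactly `4 * N * x 0 ^ 4`.
      nlinarith [mul_nonneg hN0 (by positivity : 0 ≤ x 0 ^ 4)]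

theorem HilbertBound.sum_le {K : ℝ} (h : HilbertBound A K) {Ω : Type} [Fintype Ω]
    (x : ι → Ω → ℝ) (y : κ → Ω → ℝ) {a b : ℝ} (ha : 0 < a) (hb : 0 < b)
    (hx : ∀ i, ∑ k, x i k ^ 2 ≤ a ^ 2) (hy : ∀ j, ∑ k, y j k ^ 2 ≤ b ^ 2) :
    ∑ i, ∑ j, A i j * ∑ k, x i k * y j k ≤ K * (a * b) := by
  have := h Ω (fun i k => x i k / a) (fun j k => y j k / b)
    (fun i => by simp only [div_pow, ← Finset.sum_div]; exact (div_le_one (pow_pos ha 2)).2 (hx i))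
    (fun i => by simp only [div_pow, ← Finset.sum_div]; exact (div_le_one (pow_pos hb 2)).2 (hy i))
  have e : ∑ i, ∑ j, A i j * ∑ k, x i k * y j k =
      (∑ i, ∑ j, A i j * ∑ k, x i k / a * (y j k / b)) * (a * b) := by
    simp only [Finset.sum_mul, Finset.mul_sum]
    refine Finset.sum_congr rfl fun i _ => Finset.sum_congr rfl fun j _ =>
      Finset.sum_congr rfl fun k _ => ?_
    field_simp
  rw [e]
  exact mul_le_mul_of_nonneg_right this (mul_pos ha hb).le

/-- The overshoot satisfies `|t| - 2 ≤ t ^ 2 / 8`, since `(|t| - 4) ^ 2 ≥ 0`. The tail is thus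
controlled by a fourth moment. -/
theorem clip_bounds (t : ℝ) : |max (-2) (min t 2)| ≤ 2 ∧ (max (-2) (min t 2)) ^ 2 ≤ t ^ 2 ∧
    (t - max (-2) (min t 2)) ^ 2 ≤ t ^ 4 / 64 := by
  rcases le_total t 2 with h | h
  · rcases le_total (-2) t with h' | h'
    · rw [min_eq_left h, max_eq_right h']
      exact ⟨abs_le.2 ⟨h', h⟩, le_rfl, by
        have : 0 ≤ t ^ 4 / 64 := by positivity
        simpa using this⟩
    · rw [min_eq_left h, max_eq_left h']
      refine ⟨by norm_num, by nlinarith, ?_⟩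
      have h1 : 0 ≤ -(t - -2) := by linarith
      have h2 : -(t - -2) ≤ t ^ 2 / 8 := by nlinarith [sq_nonneg (t + 4)]
      nlinarith [mul_self_le_mul_self h1 h2]
  · rw [min_eq_right h, max_eq_right (by norm_num)]
    refine ⟨by norm_num, by nlinarith, ?_⟩
    have h1 : 0 ≤ t - 2 := by linarith
    have h2 : t - 2 ≤ t ^ 2 / 8 := by nlinarith [sq_nonneg (t - 4)]
    nlinarith [mul_self_le_mul_self h1 h2]

/-- Random signs turn vectors into functions `G z` with the same inner products up to the factor
`N`. Clipping at 2 leaves a tail of relative norm at most `1/4`, as `3/64 ≤ 1/16`. The clipped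
product is bounded pointwise by `16 * D`; each of the two products containing a tail costs `K / 4`.
-/
theorem HilbertBound.improve (hA : CutBound A D) {K : ℝ} (hK : HilbertBound A K) :
    HilbertBound A (16 * D + K / 2) := by
  intro Ω₀ _ x₀ y₀ hx₀ hy₀
  let eq := Fintype.equivFin Ω₀
  obtain ⟨Ω, _, φ, hN, h2, h4⟩ := exists_rademacher (Fintype.card Ω₀)
  set N : ℝ := (Fintype.card Ω : ℝ) with hNdef
  have hN0 : 0 < N := Nat.cast_pos.2 hN
  let G : (Ω₀ → ℝ) → Ω → ℝ := fun z ω => ∑ k, φ ω k * z (eq.symm k)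
  let T : ℝ → ℝ := fun t => max (-2) (min t 2)
  have hT : ∀ t, |T t| ≤ 2 ∧ T t ^ 2 ≤ t ^ 2 ∧ (t - T t) ^ 2 ≤ t ^ 4 / 64 := clip_bounds
  have hG2 : ∀ z w : Ω₀ → ℝ, ∑ ω, G z ω * G w ω = N * ∑ k, z k * w k := by
    intro z w
    rw [h2 (fun k => z (eq.symm k)) (fun k => w (eq.symm k)),
      Equiv.sum_comp eq.symm (fun k => z k * w k)]
  have hG1 : ∀ z : Ω₀ → ℝ, ∑ k, z k ^ 2 ≤ 1 → ∑ ω, G z ω ^ 2 ≤ N := by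
    intro z hz
    have := hG2 z z
    simp only [← sq] at this
    rw [this]
    nlinarith
  have hG4 : ∀ z : Ω₀ → ℝ, ∑ k, z k ^ 2 ≤ 1 → ∑ ω, (G z ω - T (G z ω)) ^ 2 ≤ N / 16 := by
    intro z hz
    have h := h4 (fun k => z (eq.symm k))
    rw [Equiv.sum_comp eq.symm (fun k => z k ^ 2)] at h
    have hz0 : 0 ≤ ∑ k, z k ^ 2 := Finset.sum_nonneg fun _ _ => sq_nonneg _
    calc ∑ ω, (G z ω - T (G z ω)) ^ 2 ≤ ∑ ω, G z ω ^ 4 / 64 :=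
          Finset.sum_le_sum fun ω _ => (hT _).2.2
      _ = (∑ ω, G z ω ^ 4) / 64 := by rw [Finset.sum_div]
      _ ≤ (3 * N * (∑ k, z k ^ 2) ^ 2) / 64 := by gcongr
      _ ≤ (3 * N * 1 ^ 2) / 64 := by gcongr
      _ ≤ N / 16 := by linarith
  have hTG : ∀ z : Ω₀ → ℝ, ∑ k, z k ^ 2 ≤ 1 → ∑ ω, T (G z ω) ^ 2 ≤ N := fun z hz =>
    (Finset.sum_le_sum fun ω _ => (hT _).2.1).trans (hG1 z hz)
  have hs : 0 < √N := Real.sqrt_pos.2 hN0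
  have hsq : √N ^ 2 = N := Real.sq_sqrt hN0.le
  have b1 := hK.sum_le (fun i ω => G (x₀ i) ω - T (G (x₀ i) ω)) (fun j ω => T (G (y₀ j) ω))
    (a := √N / 4) (b := √N) (by positivity) hs
    (fun i => by rw [div_pow, hsq]; linarith [hG4 _ (hx₀ i)])
    (fun j => by rw [hsq]; exact hTG _ (hy₀ j))
  have b2 := hK.sum_le (fun i ω => G (x₀ i) ω) (fun j ω => G (y₀ j) ω - T (G (y₀ j) ω))
    (b := √N / 4) (a := √N) hs (by positivity)
    (fun j => by rw [hsq]; exact hG1 _ (hx₀ j))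
    (fun i => by rw [div_pow, hsq]; linarith [hG4 _ (hy₀ i)])
  have b3 : ∑ i, ∑ j, A i j * ∑ ω, T (G (x₀ i) ω) * T (G (y₀ j) ω) ≤ N * (2 ^ 2 * (4 * D)) := by
    have e : ∑ i, ∑ j, A i j * ∑ ω, T (G (x₀ i) ω) * T (G (y₀ j) ω) =
        ∑ ω, ∑ i, ∑ j, A i j * (T (G (x₀ i) ω) * T (G (y₀ j) ω)) := by
      simp only [Finset.mul_sum]
      rw [Finset.sum_comm (s := Finset.univ (α := Ω))]
      exact Finset.sum_congr rfl fun i _ => Finset.sum_comm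
    rw [e]
    refine (Finset.sum_le_sum fun ω _ => hA.sum_mul_le_of_abs_le _ _ two_pos
      (fun i => (hT _).1) (fun j => (hT _).1)).trans ?_
    simp [hNdef]
  have e : N * ∑ i, ∑ j, A i j * ∑ k, x₀ i k * y₀ j k =
      (∑ i, ∑ j, A i j * ∑ ω, T (G (x₀ i) ω) * T (G (y₀ j) ω)) +
      (∑ i, ∑ j, A i j * ∑ ω, (G (x₀ i) ω - T (G (x₀ i) ω)) * T (G (y₀ j) ω)) +
      ∑ i, ∑ j, A i j * ∑ ω, G (x₀ i) ω * (G (y₀ j) ω - T (G (y₀ j) ω)) := by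
    simp only [← Finset.sum_add_distrib, Finset.mul_sum, ← mul_add]
    refine Finset.sum_congr rfl fun i _ => Finset.sum_congr rfl fun j _ => ?_
    rw [← Finset.mul_sum, ← Finset.mul_sum, mul_left_comm, ← hG2, Finset.mul_sum]
    exact Finset.sum_congr rfl fun ω _ => by ring
  have e3 : K * (√N / 4 * √N) = K * N / 4 := by rw [← hsq]; ring_nf; rw [Real.sqrt_sq hs.le]
  have e4 : K * (√N * (√N / 4)) = K * N / 4 := by rw [← e3]; ring
  rw [e3] at b1
  rw [e4] at b2
  have : N * ∑ i, ∑ j, A i j * ∑ k, x₀ i k * y₀ j k ≤ N * (16 * D + K / 2) := by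
    rw [e]; nlinarith
  exact le_of_mul_le_mul_left this hN0

theorem abs_sum_mul_le_one {Ω : Type} [Fintype Ω] (x y : Ω → ℝ) (hx : ∑ k, x k ^ 2 ≤ 1)
    (hy : ∑ k, y k ^ 2 ≤ 1) : |∑ k, x k * y k| ≤ 1 := by
  have h := Finset.sum_mul_sq_le_sq_mul_sq Finset.univ x y
  have hx0 : 0 ≤ ∑ k, x k ^ 2 := Finset.sum_nonneg fun _ _ => sq_nonneg _
  rw [← sq_le_one_iff_abs_le_one]
  nlinarith

/-- Grothendieck's inequality (with a crude constant): rectangle sums control the bilinear form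
on vectors. -/
theorem CutBound.hilbertBound (hA : CutBound A D) : HilbertBound A (32 * D) := by
  let S : Set ℝ := {K | HilbertBound A K}
  have hne : S.Nonempty := by
    refine ⟨∑ i, ∑ j, |A i j|, fun Ω _ x y hx hy => ?_⟩
    refine Finset.sum_le_sum fun i _ => Finset.sum_le_sum fun j _ => ?_
    refine (le_abs_self _).trans ?_
    rw [abs_mul]
    exact mul_le_of_le_one_right (abs_nonneg _) (abs_sum_mul_le_one _ _ (hx i) (hy j))
  have hbd : BddBelow S := ⟨0, fun K hK => by
    simpa using hK Unit (fun _ _ => 0) (fun _ _ => 0) (by simp) (by simp)⟩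
  have hmem : HilbertBound A (sInf S) := fun Ω _ x y hx hy =>
    le_csInf hne fun K hK => hK Ω x y hx hy
  -- The best constant is itself a bound, so improving it gives a self-referential inequality that
  -- forces it below `32 * D`.
  have h1 : sInf S ≤ 16 * D + sInf S / 2 := csInf_le hbd (HilbertBound.improve hA hmem)
  exact fun Ω _ x y hx hy => (hmem Ω x y hx hy).trans (by linarith)

end

/-! ### Low rank forces a sparser rectangle -/

/-- The `x`-side lists an orthonormal basis of the column space, one unit vector per dimension. The
`y`-side lists the coordinates of the columns, so Parseval gives their norms. -/
theorem Matrix.exists_factorization {ι κ : Type} [Fintype ι] [Fintype κ] (M : Matrix ι κ ℝ) :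
    ∃ (Ω : Type) (_ : Fintype Ω) (x : ι → Ω → ℝ) (y : κ → Ω → ℝ),
      (∀ i j, M i j = ∑ k, x i k * y j k) ∧ (∑ i, ∑ k, x i k ^ 2 = M.rank) ∧
      ∀ j, ∑ k, y j k ^ 2 = ∑ i, M i j ^ 2 := by
  let u : κ → EuclideanSpace ℝ ι := fun j => WithLp.toLp 2 (M.col j)
  let U : Submodule ℝ (EuclideanSpace ℝ ι) := Submodule.span ℝ (Set.range u)
  have hrank : Module.finrank ℝ U = M.rank := by
    rw [Matrix.rank_eq_finrank_span_cols,
      ← LinearEquiv.finrank_map_eq (WithLp.linearEquiv 2 ℝ (ι → ℝ)).symm, Submodule.map_span,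
      ← Set.range_comp]
    rfl
  let b := stdOrthonormalBasis ℝ U
  let w : κ → U := fun j => ⟨u j, Submodule.subset_span ⟨j, rfl⟩⟩
  refine ⟨Fin (Module.finrank ℝ U), inferInstance, fun i k => (b k : EuclideanSpace ℝ ι) i,
    fun j k => inner ℝ (b k) (w j), ?_, ?_, ?_⟩
  · intro i j
    have h := congrArg (fun z : U => (z : EuclideanSpace ℝ ι) i) (b.sum_repr' (w j))
    simp only [Submodule.coe_sum, Submodule.coe_smul, WithLp.ofLp_sum, Finset.sum_apply,
      PiLp.smul_apply, smul_eq_mul] at h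
    rw [show M i j = (w j : EuclideanSpace ℝ ι) i from rfl, ← h]
    exact Finset.sum_congr rfl fun k _ => mul_comm _ _
  · rw [Finset.sum_comm, ← hrank]
    have : ∀ k, ∑ i, (b k : EuclideanSpace ℝ ι) i ^ 2 = 1 := fun k => by
      rw [← EuclideanSpace.real_norm_sq_eq, Submodule.norm_coe, b.norm_eq_one, one_pow]
    simp [this]
  · intro j
    have h := b.sum_sq_norm_inner_right (w j)
    simp only [Real.norm_eq_abs, sq_abs] at h
    rw [h, ← Submodule.norm_coe, EuclideanSpace.real_norm_sq_eq]
    rfl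

section
variable {ι κ : Type} [Fintype ι] [Fintype κ]

/-- The complement of a rectangle is a union of two rectangles, each of sum at least `-D`, and
everything sums to zero. -/
theorem cutBound_of_neg_le {A : ι → κ → ℝ} {D : ℝ} (h0 : ∑ i, ∑ j, A i j = 0)
    (h : ∀ (X : Finset ι) (Y : Finset κ), -D ≤ ∑ i ∈ X, ∑ j ∈ Y, A i j) :
    CutBound A (2 * D) := by
  classical
  have hD : 0 ≤ D := by simpa using h ∅ ∅
  intro X Y
  rw [abs_le]
  refine ⟨by linarith [h X Y], ?_⟩
  have e1 := Finset.sum_add_sum_compl X (fun i => ∑ j, A i j)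
  have e2 : (∑ i ∈ X, ∑ j ∈ Y, A i j) + ∑ i ∈ X, ∑ j ∈ Yᶜ, A i j = ∑ i ∈ X, ∑ j, A i j := by
    rw [← Finset.sum_add_distrib]
    exact Finset.sum_congr rfl fun i _ => Finset.sum_add_sum_compl Y _
  linarith [h X Yᶜ, h Xᶜ Finset.univ]

/-- Markov's inequality for finite sums. -/
theorem card_filter_lt_mul_le (f : ι → ℝ) (hf : ∀ i, 0 ≤ f i) (a : ℝ) :
    ((Finset.univ.filter fun i => a < f i).card : ℝ) * a ≤ ∑ i, f i := by
  calc _ ≤ ∑ i ∈ Finset.univ.filter (fun i => a < f i), f i := by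
        rw [← nsmul_eq_mul]
        exact Finset.card_nsmul_le_sum _ _ _ fun i hi => (Finset.mem_filter.1 hi).2.le
    _ ≤ _ := Finset.sum_le_univ_sum_of_nonneg hf

/-- A binary matrix of density `p` and rank at most `r` has a rectangle whose sum falls short of
the expected one by a constant times `√(p / r)`. -/
theorem exists_sparse_rectangle (M : Matrix ι κ ℝ) (hM : ∀ i j, M i j = 0 ∨ M i j = 1)
    (hm : 0 < Fintype.card ι) (hn : 0 < Fintype.card κ) {r p s t : ℝ}
    (hr : M.rank ≤ r) (ht : 0 < t) (hrt : r = t ^ 2) (hs : 0 < s) (hps : p = s ^ 2)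
    (hst : 1 ≤ 2 * s * t) (hp2 : p ≤ 1 / 2)
    (hp : ∑ i, ∑ j, M i j = p * (Fintype.card ι * Fintype.card κ)) :
    ∃ (X : Finset ι) (Y : Finset κ), ∑ i ∈ X, ∑ j ∈ Y, (M i j - p) ≤
      -(Fintype.card ι * Fintype.card κ * s / (4096 * t)) := by
  classical
  by_contra! hcon
  set m : ℝ := (Fintype.card ι : ℝ)
  set n : ℝ := (Fintype.card κ : ℝ)
  have hm0 : 0 < m := Nat.cast_pos.2 hm
  have hn0 : 0 < n := Nat.cast_pos.2 hn
  have hp0 : 0 < p := by rw [hps]; positivity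
  have hr0 : 0 < r := by rw [hrt]; positivity
  set D := m * n * s / (4096 * t) with hD
  have hDp : D * 2048 ≤ p * (m * n) := by
    have : D * 2048 = m * n * s * (1 / (2 * t)) := by rw [hD]; field_simp; ring
    rw [this, hps]
    have h1 : 1 / (2 * t) ≤ s := by rw [div_le_iff₀ (by positivity)]; linarith
    calc m * n * s * (1 / (2 * t)) ≤ m * n * s * s := by gcongr
      _ = _ := by ring
  have hsum0 : ∑ i, ∑ j, (M i j - p) = 0 := by
    simp only [Finset.sum_sub_distrib, hp]
    simp only [Finset.sum_const, Finset.card_univ, nsmul_eq_mul]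
    ring
  have hcut : CutBound (fun i j => M i j - p) (2 * D) :=
    cutBound_of_neg_le hsum0 fun X Y => (hcon X Y).le
  have hM0 : ∀ i j, 0 ≤ M i j := fun i j => by rcases hM i j with h | h <;> rw [h]; norm_num
  have hMsq : ∀ i j, M i j ^ 2 = M i j := fun i j => by rcases hM i j with h | h <;> rw [h] <;> norm_num
  -- Absence of discrepancy also keeps the few discarded rows and columns from carrying most of the
  -- ones.
  have hmass : ∀ (X : Finset ι) (Y : Finset κ),
      ∑ i ∈ X, ∑ j ∈ Y, M i j ≤ p * (X.card * Y.card) + 2 * D := by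
    intro X Y
    have := (abs_le.1 (hcut X Y)).2
    simp only [Finset.sum_sub_distrib] at this
    simp only [Finset.sum_const, nsmul_eq_mul] at this
    linarith
  obtain ⟨Ω, _, x, y, hxy, hx, hy⟩ := M.exists_factorization
  -- Long rows and dense columns; by Markov each set is at most an eighth of its side.
  set R : Finset ι := Finset.univ.filter fun i => 8 * r / m < ∑ k, x i k ^ 2 with hR
  set C : Finset κ := Finset.univ.filter fun j => 8 * p * m < ∑ i, M i j with hC
  have hRc : (R.card : ℝ) ≤ m / 8 := by
    have h := card_filter_lt_mul_le (fun i => ∑ k, x i k ^ 2)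
      (fun i => Finset.sum_nonneg fun _ _ => sq_nonneg _) (8 * r / m)
    rw [hx] at h
    have h := h.trans hr
    rw [mul_div_assoc', div_le_iff₀ hm0] at h
    nlinarith
  have hCc : (C.card : ℝ) ≤ n / 8 := by
    have h := card_filter_lt_mul_le (fun j => ∑ i, M i j)
      (fun j => Finset.sum_nonneg fun _ _ => hM0 _ _) (8 * p * m)
    rw [Finset.sum_comm, hp] at h
    have : 0 < p * m := by positivity
    nlinarith
  have hRm : ∑ i ∈ R, ∑ j, M i j ≤ p * (m * n) / 8 + 2 * D := by
    refine (hmass R Finset.univ).trans ?_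
    rw [Finset.card_univ]
    have : p * (R.card * n) ≤ p * (m / 8 * n) := by gcongr
    linarith
  have hCm : ∑ i, ∑ j ∈ C, M i j ≤ p * (m * n) / 8 + 2 * D := by
    refine (hmass Finset.univ C).trans ?_
    rw [Finset.card_univ]
    have : p * (m * C.card) ≤ p * (m * (n / 8)) := by gcongr
    linarith
  have hgood : p * (m * n) / 2 < ∑ i ∈ Rᶜ, ∑ j ∈ Cᶜ, M i j := by
    have e1 := Finset.sum_add_sum_compl R (fun i => ∑ j, M i j)
    have e2 : (∑ i ∈ Rᶜ, ∑ j ∈ C, M i j) + ∑ i ∈ Rᶜ, ∑ j ∈ Cᶜ, M i j = ∑ i ∈ Rᶜ, ∑ j, M i j := by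
      rw [← Finset.sum_add_distrib]
      exact Finset.sum_congr rfl fun i _ => Finset.sum_add_sum_compl C _
    have e3 : ∑ i ∈ Rᶜ, ∑ j ∈ C, M i j ≤ ∑ i, ∑ j ∈ C, M i j :=
      Finset.sum_le_univ_sum_of_nonneg fun i => Finset.sum_nonneg fun _ _ => hM0 _ _
    have : 0 < p * (m * n) := by positivity
    linarith
  have hbound := hcut.hilbertBound.sum_le (fun i k => if i ∈ Rᶜ then x i k else 0)
    (fun j k => if j ∈ Cᶜ then y j k else 0) (a := √(8 * r / m)) (b := √(8 * p * m))
    (Real.sqrt_pos.2 (by positivity)) (Real.sqrt_pos.2 (by positivity))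
    (fun i => by
      rw [Real.sq_sqrt (by positivity)]
      split_ifs with h
      · simpa [hR] using h
      · simp; positivity)
    (fun j => by
      rw [Real.sq_sqrt (by positivity)]
      split_ifs with h
      · rw [hy]
        simp only [hMsq]
        simpa [hC] using h
      · simp; positivity)
  have hval : ∑ i, ∑ j, (M i j - p) * ∑ k, (if i ∈ Rᶜ then x i k else 0) *
      (if j ∈ Cᶜ then y j k else 0) = (1 - p) * ∑ i ∈ Rᶜ, ∑ j ∈ Cᶜ, M i j := by
    rw [Finset.mul_sum, ← Finset.sum_subset (Finset.subset_univ Rᶜ)]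
    · refine Finset.sum_congr rfl fun i hi => ?_
      rw [Finset.mul_sum, ← Finset.sum_subset (Finset.subset_univ Cᶜ)]
      · refine Finset.sum_congr rfl fun j hj => ?_
        simp only [if_pos hi, if_pos hj]
        rw [← hxy, sub_mul, ← sq, hMsq]
        ring
      · intro j _ hj
        simp only [if_neg hj, mul_zero, Finset.sum_const_zero]
    · intro i _ hi
      simp only [if_neg hi, zero_mul, mul_zero, Finset.sum_const_zero]
  have hab : √(8 * r / m) * √(8 * p * m) = 8 * (s * t) := by
    rw [← Real.sqrt_mul (by positivity), Real.sqrt_eq_iff_mul_self_eq (by positivity) (by positivity),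
      hrt, hps]
    field_simp
  rw [hval, hab] at hbound
  -- The constant 4096 makes the Grothendieck bound `p * (m * n) / 8`, while the form exceeds `p *
  -- (m * n) / 4`.
  have hfin : 32 * (2 * D) * (8 * (s * t)) = p * (m * n) / 8 := by
    rw [hD, hps]; field_simp; ring
  rw [hfin] at hbound
  have : 0 < p * (m * n) := by positivity
  nlinarith

/-! ### Very sparse matrices -/

/-- A binary matrix of rank `r` with density at most `1 / (4 r)` has an all-zero rectangle on half
of the rows and half of the columns. -/
theorem exists_zero_rectangle_of_sparse (M : Matrix ι κ ℝ) (hM : ∀ i j, M i j = 0 ∨ M i j = 1)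
    (hm : 0 < Fintype.card ι) (hn : 0 < Fintype.card κ) {r p : ℝ}
    (hr : M.rank ≤ r) (hr0 : 0 < r) (hp4 : p * (4 * r) ≤ 1)
    (hp : ∑ i, ∑ j, M i j = p * (Fintype.card ι * Fintype.card κ)) :
    ∃ (X : Finset ι) (Y : Finset κ), (Fintype.card ι : ℝ) / 2 ≤ X.card ∧
      (Fintype.card κ : ℝ) / 2 ≤ Y.card ∧ ∀ i ∈ X, ∀ j ∈ Y, M i j = 0 := by
  classical
  set m : ℝ := (Fintype.card ι : ℝ)
  set n : ℝ := (Fintype.card κ : ℝ)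
  have hm0 : 0 < m := Nat.cast_pos.2 hm
  have hn0 : 0 < n := Nat.cast_pos.2 hn
  have hM0 : ∀ i j, 0 ≤ M i j := fun i j => by rcases hM i j with h | h <;> rw [h]; norm_num
  set Y : Finset κ := Finset.univ.filter fun j => ¬ m / (2 * r) < ∑ i, M i j with hY
  have hYc : n / 2 ≤ Y.card := by
    have h := card_filter_lt_mul_le (fun j => ∑ i, M i j)
      (fun j => Finset.sum_nonneg fun _ _ => hM0 _ _) (m / (2 * r))
    have h1 := Finset.card_filter_add_card_filter_not (s := (Finset.univ : Finset κ))
      (fun j => m / (2 * r) < ∑ i, M i j)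
    have h2 : ((Finset.univ.filter fun j => m / (2 * r) < ∑ i, M i j).card : ℝ) + Y.card = n := by
      rw [hY, ← Nat.cast_add, h1, Finset.card_univ]
    rw [Finset.sum_comm, hp, mul_div_assoc', div_le_iff₀ (by positivity)] at h
    have h3 : p * (m * n) * (2 * r) ≤ m * n / 2 := by
      have : 0 < m * n := by positivity
      nlinarith
    have h4 : ((Finset.univ.filter fun j => m / (2 * r) < ∑ i, M i j).card : ℝ) ≤ n / 2 :=
      le_of_mul_le_mul_right (by linarith) hm0
    linarith
  let S : Set (ι → ℝ) := M.col '' Y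
  -- The basis consists of columns from `Y`, hence is binary and sparse. At most `r` supports of
  -- size `m / (2 * r)` cover at most half the rows, and off them every column of `Y` vanishes.
  obtain ⟨f, hfS, hfspan, -⟩ := Submodule.exists_fun_fin_finrank_span_eq ℝ S
  have hdim : (Module.finrank ℝ (Submodule.span ℝ S) : ℝ) ≤ r := by
    refine le_trans ?_ hr
    rw [Matrix.rank_eq_finrank_span_cols]
    exact_mod_cast Submodule.finrank_mono (Submodule.span_mono (Set.image_subset_range _ _))
  have hf : ∀ k, (∀ i, f k i = 0 ∨ f k i = 1) ∧ ∑ i, f k i ≤ m / (2 * r) := by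
    intro k
    obtain ⟨j, hj, hjk⟩ := hfS k
    rw [← hjk]
    refine ⟨fun i => hM i j, ?_⟩
    have := Finset.mem_coe.1 hj
    rw [hY, Finset.mem_filter] at this
    exact not_lt.1 this.2
  refine ⟨Finset.univ.filter fun i => ¬ 0 < ∑ k, f k i, Y, ?_, hYc, ?_⟩
  · have h1 := Finset.card_filter_add_card_filter_not (s := (Finset.univ : Finset ι))
      (fun i => 0 < ∑ k, f k i)
    have h2 : ((Finset.univ.filter fun i => 0 < ∑ k, f k i).card : ℝ) +
      (Finset.univ.filter fun i => ¬ 0 < ∑ k, f k i).card = m := by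
      rw [← Nat.cast_add, h1, Finset.card_univ]
    have h3 : ((Finset.univ.filter fun i => 0 < ∑ k, f k i).card : ℝ) ≤ ∑ i, ∑ k, f k i := by
      rw [Finset.card_eq_sum_ones, Nat.cast_sum, Finset.sum_filter]
      refine Finset.sum_le_sum fun i _ => ?_
      have hnn : ∀ k, 0 ≤ f k i := fun k => by rcases (hf k).1 i with h | h <;> rw [h]; norm_num
      split_ifs with h
      · obtain ⟨k, -, hk⟩ := Finset.exists_ne_zero_of_sum_ne_zero h.ne'
        rw [Nat.cast_one, ← ((hf k).1 i).resolve_left hk]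
        exact Finset.single_le_sum (f := fun k => f k i) (fun k _ => hnn k) (Finset.mem_univ k)
      · exact Finset.sum_nonneg fun k _ => hnn k
    have h4 : ∑ i, ∑ k, f k i ≤ m / 2 := by
      rw [Finset.sum_comm]
      calc ∑ k, ∑ i, f k i ≤ ∑ _k : Fin (Module.finrank ℝ (Submodule.span ℝ S)), m / (2 * r) :=
            Finset.sum_le_sum fun k _ => (hf k).2
        _ = Module.finrank ℝ (Submodule.span ℝ S) * (m / (2 * r)) := by simp
        _ ≤ r * (m / (2 * r)) := by gcongr
        _ = m / 2 := by field_simp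
    linarith
  · intro i hi j hj
    have hi := not_lt.1 (Finset.mem_filter.1 hi).2
    have hnn : ∀ k, 0 ≤ f k i := fun k => by rcases (hf k).1 i with h | h <;> rw [h]; norm_num
    have hz : ∀ k, f k i = 0 := fun k =>
      (Finset.sum_eq_zero_iff_of_nonneg fun k _ => hnn k).1
        (le_antisymm hi (Finset.sum_nonneg fun k _ => hnn k)) k (Finset.mem_univ k)
    have hle : Submodule.span ℝ S ≤ LinearMap.ker (LinearMap.proj i : (ι → ℝ) →ₗ[ℝ] ℝ) := by
      rw [← hfspan, Submodule.span_le]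
      rintro _ ⟨k, rfl⟩
      exact hz k
    exact hle (Submodule.subset_span ⟨j, hj, rfl⟩ : M.col j ∈ Submodule.span ℝ S)

end

/-! ### Density decrement -/

section
variable {ι κ : Type} [Fintype ι] [Fintype κ]

/-- Density decrement: repeatedly passing to sparser rectangles reaches density `1 / (4 r)`, and the
total loss telescopes in the square root of the density. -/
theorem exists_zero_rectangle {r t : ℝ} (ht : 0 < t) (hrt : r = t ^ 2) (N : ℕ) :
    ∀ {ι κ : Type} [Fintype ι] [Fintype κ] (M : Matrix ι κ ℝ) (s : ℝ),
      Fintype.card ι + Fintype.card κ ≤ N → (∀ i j, M i j = 0 ∨ M i j = 1) →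
      0 < Fintype.card ι → 0 < Fintype.card κ → M.rank ≤ r → 0 ≤ s → s ^ 2 ≤ 1 / 2 →
      ∑ i, ∑ j, M i j = s ^ 2 * (Fintype.card ι * Fintype.card κ) →
      ∃ (X : Finset ι) (Y : Finset κ),
        (Fintype.card ι : ℝ) ≤ X.card * (2 * Real.exp (8192 * t * s)) ∧
        (Fintype.card κ : ℝ) ≤ Y.card * (2 * Real.exp (8192 * t * s)) ∧
        ∀ i ∈ X, ∀ j ∈ Y, M i j = 0 := by
  classical
  have hr0 : 0 < r := by rw [hrt]; positivity
  induction N with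
  | zero => intro ι κ _ _ M s hN _ hm; omega
  | succ N ih =>
    intro ι κ _ _ M s hN hM hm hn hr hs hs2 hp
    set m : ℝ := (Fintype.card ι : ℝ) with hmdef
    set n : ℝ := (Fintype.card κ : ℝ) with hndef
    have hm0 : 0 < m := Nat.cast_pos.2 hm
    have hn0 : 0 < n := Nat.cast_pos.2 hn
    by_cases hst : s ^ 2 * (4 * r) ≤ 1
    · obtain ⟨X, Y, hX, hY, h0⟩ := exists_zero_rectangle_of_sparse M hM hm hn hr hr0 hst hp
      have he : 1 ≤ Real.exp (8192 * t * s) := Real.one_le_exp (by positivity)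
      refine ⟨X, Y, ?_, ?_, h0⟩
      · nlinarith [(Nat.cast_nonneg X.card : (0 : ℝ) ≤ X.card)]
      · nlinarith [(Nat.cast_nonneg Y.card : (0 : ℝ) ≤ Y.card)]
    · have hst' : 1 < 2 * s * t := by
        rw [hrt] at hst
        by_contra hc
        have : 0 ≤ 2 * s * t := by positivity
        exact hst (by nlinarith)
      have hs0 : 0 < s := by
        rcases hs.eq_or_lt with h | h
        · rw [← h] at hst'; norm_num at hst'
        · exact h
      obtain ⟨X, Y, hXY⟩ := exists_sparse_rectangle M hM hm hn hr ht hrt hs0 rfl hst'.le hs2 hp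
      have hneg : ∑ i ∈ X, ∑ j ∈ Y, (M i j - s ^ 2) < 0 :=
        hXY.trans_lt (neg_lt_zero.2 (by positivity))
      have hXne : X.Nonempty := by
        rw [Finset.nonempty_iff_ne_empty]; rintro rfl; simp at hneg
      have hYne : Y.Nonempty := by
        rw [Finset.nonempty_iff_ne_empty]; rintro rfl; simp at hneg
      -- The full rectangle has sum zero, so the one found is proper and the induction on total size
      -- applies.
      have hlt : X.card + Y.card < Fintype.card ι + Fintype.card κ := by
        by_contra hc
        have hX := Finset.card_le_univ X
        have hY := Finset.card_le_univ Y
        rw [(Finset.card_eq_iff_eq_univ X).1 (by omega),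
          (Finset.card_eq_iff_eq_univ Y).1 (by omega)] at hneg
        simp only [Finset.sum_sub_distrib, hp] at hneg
        simp only [Finset.sum_const, Finset.card_univ, nsmul_eq_mul] at hneg
        rw [← hmdef, ← hndef] at hneg
        linarith
      set x : ℝ := (X.card : ℝ) with hx
      set y : ℝ := (Y.card : ℝ) with hy
      have hx0 : 0 < x := Nat.cast_pos.2 hXne.card_pos
      have hy0 : 0 < y := Nat.cast_pos.2 hYne.card_pos
      have hxm : x ≤ m := Nat.cast_le.2 (Finset.card_le_univ X)
      have hyn : y ≤ n := Nat.cast_le.2 (Finset.card_le_univ Y)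
      have hM0 : ∀ i j, 0 ≤ M i j := fun i j => by rcases hM i j with h | h <;> rw [h]; norm_num
      set w := ∑ i ∈ X, ∑ j ∈ Y, M i j with hw
      have hw0 : 0 ≤ w := Finset.sum_nonneg fun _ _ => Finset.sum_nonneg fun _ _ => hM0 _ _
      set s' := √(w / (x * y)) with hs'
      have hs'0 : 0 ≤ s' := Real.sqrt_nonneg _
      have hws : w = s' ^ 2 * (x * y) := by
        rw [hs', Real.sq_sqrt (by positivity)]; field_simp
      clear_value s' w x y
      have hdec : m * n * s / (4096 * t) ≤ (s ^ 2 - s' ^ 2) * (x * y) := by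
        simp only [Finset.sum_sub_distrib] at hXY
        simp only [Finset.sum_const, nsmul_eq_mul] at hXY
        rw [← hw, hws, ← hx, ← hy] at hXY
        linarith
      have hss : s' < s := by
        have h1 : 0 < m * n * s / (4096 * t) := by positivity
        have h2 := pos_of_mul_pos_left (h1.trans_le hdec) (mul_pos hx0 hy0).le
        exact lt_of_pow_lt_pow_left₀ 2 hs (by linarith)
      have hfac : s ^ 2 - s' ^ 2 ≤ (s - s') * (2 * s) := by nlinarith only [hss]
      have hmn : m * n ≤ 8192 * t * (s - s') * (x * y) := by
        rw [div_le_iff₀ (by positivity)] at hdec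
        have h2 : (s ^ 2 - s' ^ 2) * (x * y) * (4096 * t) ≤
            (s - s') * (2 * s) * (x * y) * (4096 * t) := by gcongr
        exact le_of_mul_le_mul_right (by linarith) hs0
      set E := 8192 * t * (s - s') with hE
      have hE0 : 0 ≤ E := mul_nonneg (by positivity) (by linarith)
      -- From `m * n ≤ E * (x * y)`, each side shrinks by at most a factor `E`, since the other does
      -- not grow. Replacing `E` by `exp E` makes the factors telescope; the 2 is paid only in the
      -- base case.
      have hEe : E ≤ Real.exp E := by linarith [Real.add_one_le_exp E]
      have hmx : m ≤ x * Real.exp E := by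
        have h1 : E * (x * y) ≤ E * (x * n) := by gcongr
        have h2 : m ≤ E * x := le_of_mul_le_mul_right (by linarith) hn0
        exact h2.trans (by rw [mul_comm]; gcongr)
      have hny : n ≤ y * Real.exp E := by
        have h1 : E * (x * y) ≤ E * (m * y) := by gcongr
        have h2 : n ≤ E * y := le_of_mul_le_mul_left (by linarith) hm0
        exact h2.trans (by rw [mul_comm]; gcongr)
      have hexp : Real.exp E * Real.exp (8192 * t * s') = Real.exp (8192 * t * s) := by
        rw [← Real.exp_add, hE]; ring_nf
      obtain ⟨X', Y', hX', hY', h0⟩ := ih (M.submatrix (Subtype.val : X → ι) (Subtype.val : Y → κ)) s'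
        (by simp only [Fintype.card_coe]; omega) (fun i j => hM i j)
        (by simpa using hXne) (by simpa using hYne)
        ((Nat.cast_le.2 (M.rank_submatrix_le _ _)).trans hr) hs'0
        ((pow_le_pow_left₀ hs'0 hss.le 2).trans hs2)
        (by
          simp only [Fintype.card_coe, Matrix.submatrix_apply]
          rw [← hx, ← hy, ← hws, hw, ← Finset.sum_coe_sort X]
          exact Finset.sum_congr rfl fun i _ => Finset.sum_coe_sort Y (fun j => M i j))
      simp only [Fintype.card_coe] at hX' hY'
      rw [← hx] at hX'
      rw [← hy] at hY'
      refine ⟨X'.map (Function.Embedding.subtype _), Y'.map (Function.Embedding.subtype _), ?_, ?_, ?_⟩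
      · rw [Finset.card_map, ← hexp]
        calc m ≤ x * Real.exp E := hmx
          _ ≤ X'.card * (2 * Real.exp (8192 * t * s')) * Real.exp E := by gcongr
          _ = _ := by ring
      · rw [Finset.card_map, ← hexp]
        calc n ≤ y * Real.exp E := hny
          _ ≤ Y'.card * (2 * Real.exp (8192 * t * s')) * Real.exp E := by gcongr
          _ = _ := by ring
      · intro i hi j hj
        obtain ⟨i', hi', rfl⟩ := Finset.mem_map.1 hi
        obtain ⟨j', hj', rfl⟩ := Finset.mem_map.1 hj
        exact h0 i' hi' j' hj'

/-! ### Complementation and the final constant -/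

theorem Matrix.rank_one_sub_le (M : Matrix ι κ ℝ) :
    (Matrix.of fun i j => 1 - M i j).rank ≤ M.rank + 1 := by
  rw [Matrix.rank_eq_finrank_span_cols, Matrix.rank_eq_finrank_span_cols]
  have h : Submodule.span ℝ (Set.range (Matrix.of fun i j => 1 - M i j).col) ≤
      Submodule.span ℝ (Set.range M.col) ⊔ Submodule.span ℝ {fun _ => (1 : ℝ)} := by
    rw [Submodule.span_le]
    rintro _ ⟨j, rfl⟩
    have e : (Matrix.of fun i j => 1 - M i j).col j = -M.col j + fun _ => (1 : ℝ) := by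
      ext i
      simp [Matrix.col]
      ring
    rw [e]
    exact Submodule.add_mem_sup (neg_mem (Submodule.subset_span ⟨j, rfl⟩))
      (Submodule.subset_span rfl)
  refine (Submodule.finrank_mono h).trans ((Submodule.finrank_add_le_finrank_add_finrank _ _).trans ?_)
  exact Nat.add_le_add_left ((finrank_span_le_card _).trans (by simp)) _

/-- A binary matrix of density at most one half and rank at most `r` has a large all-zero
rectangle. -/
theorem exists_zero_rectangle_of_density_le_half (M : Matrix ι κ ℝ)
    (hM : ∀ i j, M i j = 0 ∨ M i j = 1) (hm : 0 < Fintype.card ι) (hn : 0 < Fintype.card κ)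
    {t : ℝ} (ht : 0 < t) (hr : M.rank ≤ t ^ 2)
    (hp : ∑ i, ∑ j, M i j ≤ Fintype.card ι * Fintype.card κ / 2) :
    ∃ (X : Finset ι) (Y : Finset κ),
      (Fintype.card ι : ℝ) ≤ X.card * (2 * Real.exp (8192 * t)) ∧
      (Fintype.card κ : ℝ) ≤ Y.card * (2 * Real.exp (8192 * t)) ∧
      ∀ i ∈ X, ∀ j ∈ Y, M i j = 0 := by
  have hm0 : (0 : ℝ) < Fintype.card ι := Nat.cast_pos.2 hm
  have hn0 : (0 : ℝ) < Fintype.card κ := Nat.cast_pos.2 hn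
  have hM0 : ∀ i j, 0 ≤ M i j := fun i j => by rcases hM i j with h | h <;> rw [h]; norm_num
  have hw0 : 0 ≤ ∑ i, ∑ j, M i j :=
    Finset.sum_nonneg fun _ _ => Finset.sum_nonneg fun _ _ => hM0 _ _
  set s := √((∑ i, ∑ j, M i j) / (Fintype.card ι * Fintype.card κ)) with hs
  have hs2 : s ^ 2 = (∑ i, ∑ j, M i j) / (Fintype.card ι * Fintype.card κ) :=
    Real.sq_sqrt (by positivity)
  have hs2' : s ^ 2 ≤ 1 / 2 := by
    rw [hs2, div_le_iff₀ (by positivity)]; linarith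
  have hs1 : s ≤ 1 := by nlinarith
  obtain ⟨X, Y, hX, hY, h0⟩ := exists_zero_rectangle ht rfl _ M s le_rfl hM hm hn hr
    (Real.sqrt_nonneg _) hs2' (by rw [hs2]; field_simp)
  have he : Real.exp (8192 * t * s) ≤ Real.exp (8192 * t) :=
    Real.exp_le_exp.2 (mul_le_of_le_one_right (by positivity) hs1)
  exact ⟨X, Y, hX.trans (by gcongr), hY.trans (by gcongr), h0⟩

end

/-- The factor 2 is absorbed in `exp u`, and `log 2 > 1/2` gives `16385 ≤ 32770 * log 2`. -/
theorem two_mul_exp_le_two_rpow {u : ℝ} (hu : 1 ≤ u) :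
    2 * Real.exp (8192 * (2 * u)) ≤ (2 : ℝ) ^ (32770 * u) := by
  have h2 : (2 : ℝ) ≤ Real.exp u := by linarith [Real.add_one_le_exp u]
  rw [Real.rpow_def_of_pos two_pos]
  calc 2 * Real.exp (8192 * (2 * u)) ≤ Real.exp u * Real.exp (8192 * (2 * u)) := by gcongr
    _ = Real.exp (16385 * u) := by rw [← Real.exp_add]; ring_nf
    _ ≤ _ := Real.exp_le_exp.2 (by nlinarith [Real.log_two_gt_d9])

theorem theorem1 :
    ∃ c : ℝ, 0 < c ∧
      ∀ (m n r : ℕ) (M : Matrix (Fin m) (Fin n) ℝ),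
        (∀ i j, M i j = 0 ∨ M i j = 1) →
        M.rank ≤ r →
        ∃ (X : Finset (Fin m)) (Y : Finset (Fin n)),
          (m : ℝ) / (2 : ℝ) ^ (c * Real.sqrt (r : ℝ)) ≤ (X.card : ℝ) ∧
          (n : ℝ) / (2 : ℝ) ^ (c * Real.sqrt (r : ℝ)) ≤ (Y.card : ℝ) ∧
          ((∀ i ∈ X, ∀ j ∈ Y, M i j = 0) ∨ (∀ i ∈ X, ∀ j ∈ Y, M i j = 1)) := by
  refine ⟨32770, by norm_num, fun m n r M hM hr => ?_⟩
  have hpow : (1 : ℝ) ≤ (2 : ℝ) ^ (32770 * √(r : ℝ)) :=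
    Real.one_le_rpow one_le_two (by positivity)
  have triv : (∀ i j, M i j = 0) → ∃ (X : Finset (Fin m)) (Y : Finset (Fin n)),
      (m : ℝ) / (2 : ℝ) ^ (32770 * √(r : ℝ)) ≤ (X.card : ℝ) ∧
      (n : ℝ) / (2 : ℝ) ^ (32770 * √(r : ℝ)) ≤ (Y.card : ℝ) ∧
      ((∀ i ∈ X, ∀ j ∈ Y, M i j = 0) ∨ (∀ i ∈ X, ∀ j ∈ Y, M i j = 1)) := fun h =>
    ⟨Finset.univ, Finset.univ, by simpa using div_le_self (Nat.cast_nonneg m) hpow,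
      by simpa using div_le_self (Nat.cast_nonneg n) hpow, Or.inl fun i _ j _ => h i j⟩
  rcases Nat.eq_zero_or_pos m with rfl | hm
  · exact triv fun i => i.elim0
  rcases Nat.eq_zero_or_pos n with rfl | hn
  · exact triv fun _ j => j.elim0
  rcases Nat.eq_zero_or_pos r with rfl | hr0
  · have h0 := Nat.le_zero.1 hr
    rw [Matrix.rank_eq_finrank_span_cols, Submodule.finrank_eq_zero, Submodule.span_eq_bot] at h0
    exact triv fun i j => congrFun (h0 _ ⟨j, rfl⟩) i
  have hr1 : (1 : ℝ) ≤ r := by exact_mod_cast hr0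
  have hsq : √(r : ℝ) ^ 2 = r := Real.sq_sqrt (Nat.cast_nonneg r)
  have hu : 1 ≤ √(r : ℝ) := Real.one_le_sqrt.2 hr1
  -- Taking `t = 2 * √r` leaves room for the complement, whose rank is at most `r + 1 ≤ 4 * r`.
  have ht : 0 < 2 * √(r : ℝ) := by linarith
  have hle : ∀ (k l : ℕ), (k : ℝ) ≤ l * (2 * Real.exp (8192 * (2 * √(r : ℝ)))) →
      (k : ℝ) / (2 : ℝ) ^ (32770 * √(r : ℝ)) ≤ l := fun k l h => by
    rw [div_le_iff₀ (by linarith)]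
    exact h.trans (by gcongr; exact two_mul_exp_le_two_rpow hu)
  have hrR : (M.rank : ℝ) ≤ r := by exact_mod_cast hr
  by_cases hp : ∑ i, ∑ j, M i j ≤ (m : ℝ) * n / 2
  · obtain ⟨X, Y, hX, hY, h0⟩ := exists_zero_rectangle_of_density_le_half M hM
      (by simpa using hm) (by simpa using hn) ht (by nlinarith) (by simpa using hp)
    simp only [Fintype.card_fin] at hX hY
    exact ⟨X, Y, hle _ _ hX, hle _ _ hY, Or.inl h0⟩
  · have hrank : ((Matrix.of fun i j => 1 - M i j).rank : ℝ) ≤ M.rank + 1 := by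
      exact_mod_cast M.rank_one_sub_le
    obtain ⟨X, Y, hX, hY, h0⟩ := exists_zero_rectangle_of_density_le_half
      (Matrix.of fun i j => 1 - M i j)
      (fun i j => by rcases hM i j with h | h <;> simp [h])
      (by simpa using hm) (by simpa using hn) ht (by nlinarith) (by
        simp only [Matrix.of_apply, Finset.sum_sub_distrib, Finset.sum_const, Finset.card_univ,
          Fintype.card_fin, nsmul_eq_mul]
        linarith)
    simp only [Fintype.card_fin] at hX hY
    exact ⟨X, Y, hle _ _ hX, hle _ _ hY,
      Or.inr fun i hi j hj => by have := h0 i hi j hj; simp only [Matrix.of_apply] at this; linarith⟩
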